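/- **Model.** A labelled graph $(G,\ell)$ is a nonempty finite simple graph $G=(V,E)$ with a label $\ell(u)\in\{0,1\}^*$ for every $u\in V$; a distributed language is a set of labelled graphs. Fix a polynomially bounded function $N:\mathbb N\to\mathbb N$ with $N(n)\ge n$. In an $n$-node network every node $u$ has an identifier $\mathsf{id}(u)\in\{1,\dots,N(n)\}$, distinct nodes having distinct identifiers, and initially knows $n$, $\mathsf{id}(u)$, $\ell(u)$ and the identifiers of its neighbours. All nodes run the same deterministic synchronous algorithm, with unbounded local computation. In a LOCAL round every node sends to each of its neighbours a message of arbitrary (finite) length, possibly different for different neighbours. In a BCC (Broadcast Congested Clique) round every node sends one and the same message of $O(\log n)$ bits to all nodes of the network. An algorithm decides a language $\mathcal L$ if, for every labelled graph $(G,\ell)$ and every assignment of identifiers, $(G,\ell)\in\mathcal L$ if and only if all nodes accept. Let $\mathbf L^*$ (respectively $\mathbf B^*$) be the class of languages decided, for some constant $t\ge 0$, by an algorithm performing $t$ rounds of LOCAL (respectively $t$ rounds of BCC), and let $\mathbf{BL}$ be the class of languages decided by an algorithm performing one BCC round followed by one LOCAL round. **Theorem.** $\mathbf{BL}\smallsetminus(\mathbf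 B^*\cup\mathbf L^*)\neq\varnothing$. More precisely, the language *triangle-on-max-degree-freeness*, consisting of all labelled graphs $(G,\ell)$ such that, for every triangle $T$ of $G$, all nodes of $T$ have degree smaller than the maximum degree of $G$, belongs to $\mathbf{BL}$ but neither to $\mathbf B^*$ nor to $\mathbf L^*$. -/

import Mathlib

/-- A labelled graph `(G, ℓ)`: a nonempty finite simple graph together with a binary string at
every vertex. -/
structure LabeledGraph where
  V : Type
  [fintypeV : Fintype V]
  [nonemptyV : Nonempty V]
  graph : SimpleGraph V
  label : V → List Bool

attribute [instance] LabeledGraph.fintypeV LabeledGraph.nonemptyV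

namespace LabeledGraph

/-- The number of vertices. -/
def size (G : LabeledGraph) : ℕ := Fintype.card G.V

open Classical in
/-- The finite set of neighbours of a vertex. -/
noncomputable def nbrs (G : LabeledGraph) (v : G.V) : Finset G.V :=
  Finset.univ.filter fun u => G.graph.Adj v u

/-- `ident` is an admissible assignment of identifiers with range bound `N`: it is one-to-one with
values in `{1, …, N n}`, where `n` is the number of vertices. -/
def IsIdAssignment (N : ℕ → ℕ) (G : LabeledGraph) (ident : G.V → ℕ) : Prop :=
  Function.Injective ident ∧ ∀ v, 1 ≤ ident v ∧ ident v ≤ N G.size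

end LabeledGraph

/-- A distributed language is a collection of labelled graphs. -/
abbrev DistLanguage : Type 1 := Set LabeledGraph

/-- What a node knows before any communication: the number of nodes of the network, its own
identifier, its own label, and the identifiers of its neighbours. -/
structure NodeInput where
  size : ℕ
  ident : ℕ
  label : List Bool
  nbrIds : Finset ℕ

/-- The two kinds of synchronous communication rounds. -/
inductive RoundKind where
  /-- a round of LOCAL -/
  | loc
  /-- a round of Broadcast Congested Clique -/
  | bcc

/-- A deterministic distributed algorithm, executed by every node. Local computation is unbounded.
Messages are binary strings; the messages received in a round form a finite set of pairs
(identifier of the sender, message). -/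
structure DistAlgorithm where
  /-- local states -/
  State : Type
  /-- initial state of a node -/
  init : NodeInput → State
  /-- message broadcast to all nodes, if the round is a BCC round -/
  bcast : State → List Bool
  /-- message sent to the neighbour with the given identifier, if the round is a LOCAL round -/
  send : State → ℕ → List Bool
  /-- new state after receiving the messages of a round -/
  update : State → Finset (ℕ × List Bool) → State
  /-- final decision of a node -/
  accept : State → Prop

namespace DistAlgorithm

variable (A : DistAlgorithm) (G : LabeledGraph) (ident : G.V → ℕ)

/-- The initial state of every node. -/
noncomputable def start (v : G.V) : A.State :=
  A.init ⟨G.size, ident v, G.label v, (G.nbrs v).image ident⟩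

/-- The messages received by node `v` in a round of the given kind, when the states of the nodes at
the beginning of the round are `s`: in a LOCAL round, one message from each neighbour, which may
depend on the recipient; in a BCC round, the message broadcast by each node. -/
noncomputable def received (s : G.V → A.State) (v : G.V) : RoundKind → Finset (ℕ × List Bool)
  | .loc => (G.nbrs v).image fun u => (ident u, A.send (s u) (ident v))
  | .bcc => Finset.univ.image fun u => (ident u, A.bcast (s u))

/-- The states of the nodes after one round of the given kind. -/
noncomputable def step (s : G.V → A.State) (r : RoundKind) : G.V → A.State :=
  fun v => A.update (s v) (A.received G ident s v r)

/-- The states of the nodes after the given sequence of rounds, from the initial states. -/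
noncomputable def run (rounds : List RoundKind) : G.V → A.State :=
  rounds.foldl (A.step G ident) (A.start G ident)

/-- In every BCC round of the schedule `rounds`, at most `b` bits are broadcast by each node. -/
def BandwidthAtMost (rounds : List RoundKind) (b : ℕ) : Prop :=
  ∀ (before after : List RoundKind), rounds = before ++ RoundKind.bcc :: after →
    ∀ v : G.V, (A.bcast (A.run G ident before v)).length ≤ b

end DistAlgorithm

/-- The class of languages decided by an algorithm that performs the given sequence of rounds, when
identifiers are taken from `{1, …, N n}` in `n`-node networks. Messages of BCC rounds have `O(log n)`
bits, messages of LOCAL rounds are unrestricted. The algorithm has to be correct for every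
assignment of identifiers: a labelled graph is in the language if and only if all nodes accept. -/
def HybridClass (N : ℕ → ℕ) (rounds : List RoundKind) : Set DistLanguage :=
  {L | ∃ (A : DistAlgorithm) (c : ℕ), ∀ (G : LabeledGraph) (ident : G.V → ℕ),
    G.IsIdAssignment N ident →
      A.BandwidthAtMost G ident rounds (c * (Nat.log 2 G.size + 1)) ∧
      (G ∈ L ↔ ∀ v, A.accept (A.run G ident rounds v))}

/-- **L***: languages decided in a constant number of rounds of LOCAL. -/
def LStar (N : ℕ → ℕ) : Set DistLanguage :=
  ⋃ t : ℕ, HybridClass N (List.replicate t RoundKind.loc)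

/-- **B***: languages decided in a constant number of rounds of BCC. -/
def BStar (N : ℕ → ℕ) : Set DistLanguage :=
  ⋃ t : ℕ, HybridClass N (List.replicate t RoundKind.bcc)

/-- **BL**: languages decided by one round of BCC followed by one round of LOCAL. -/
def ClassBL (N : ℕ → ℕ) : Set DistLanguage :=
  HybridClass N [RoundKind.bcc, RoundKind.loc]

open Classical in
/-- The language triangle-on-max-degree-freeness: in every triangle, all nodes have degree smaller
than the maximum degree of the graph. -/
def TOMDF : DistLanguage :=
  {G | ∀ T : Finset G.V, G.graph.IsNClique 3 T →
    ∀ v ∈ T, G.graph.degree v < G.graph.maxDegree}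

/-! Membership in **BL**: once all degrees are broadcast, a node knows whether its own degree is
maximum, and the neighbour lists of its neighbours show whether it lies on a triangle.

Outside **L***: a node of a triangle cannot see whether a larger degree occurs in another component,
so an isolated triangle is accepted once a triangle beside a star is (`run_loc_congr`,
`TOMDF_notMem_LStar`).

Outside **B***: three-party disjointness in the number-on-forehead model is encoded. The `m ^ 3`
cells `(u, v, w)` of a cube are the elements, and each cell is a potential triangle `a u v`, `b v
w`, `c u w` whose edges are governed by three sets of cells `x`, `y`, `z`. The neighbourhoods of the
`a`, `b` and `c` vertices do not depend on `x`, `y` and `z` respectively, so each family acts as a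
player blind to one set. Twins give every `a u v` the maximum degree `2 * m`, so the language holds
exactly when the sets have no common cell. The transcript of `t` rounds of bandwidth `β` has at most
`(β + 1) * t * 5 * m ^ 2` bits of information, while disjointness needs `m ^ 3 / 116`
(`card_le_of_coloring_bits`, `cube_le_of_decides`); with `β` of order `log m` this is impossible for
large `m`.

The disjointness bound is a discrepancy argument. Triples with equal transcripts form a cylinder
intersection. A sign kernel equal to `1` on disjoint triples has small box norm, so every such class
is small, and many are needed to cover all disjoint triples. -/

/-! ### Discrepancy of cylinder intersections. -/

section CylinderIntersections

theorem sq_sum_mul_le_card_mul_sum_sq {α : Type*} [Fintype α] (f F : α → ℤ)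
    (hf : ∀ a, |f a| ≤ 1) :
    (∑ a, f a * F a) ^ 2 ≤ Fintype.card α * ∑ a, F a ^ 2 := by
  refine (sq_sum_le_card_mul_sum_sq (s := Finset.univ) (f := fun a => f a * F a)).trans ?_
  rw [Finset.card_univ]
  refine mul_le_mul_of_nonneg_left (Finset.sum_le_sum fun a _ => ?_) (Nat.cast_nonneg _)
  rw [mul_pow]
  have h1 : f a ^ 2 ≤ 1 := by
    rw [← sq_abs]
    exact pow_le_one₀ (abs_nonneg _) (hf a)
  exact mul_le_of_le_one_left (sq_nonneg _) h1

variable {X Y Z : Type*} [Fintype X] [Fintype Y] [Fintype Z]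

theorem sum_sum_sum_sum_comm (F : X → X → Y → Z → ℤ) :
    ∑ y, ∑ z, ∑ x, ∑ x', F x x' y z = ∑ x, ∑ x', ∑ z, ∑ y, F x x' y z := by
  calc ∑ y, ∑ z, ∑ x, ∑ x', F x x' y z
      = ∑ z, ∑ y, ∑ x, ∑ x', F x x' y z := Finset.sum_comm
    _ = ∑ z, ∑ x, ∑ y, ∑ x', F x x' y z := Finset.sum_congr rfl fun z _ => Finset.sum_comm
    _ = ∑ x, ∑ z, ∑ y, ∑ x', F x x' y z := Finset.sum_comm
    _ = ∑ x, ∑ z, ∑ x', ∑ y, F x x' y z := Finset.sum_congr rfl fun x _ =>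
        Finset.sum_congr rfl fun z _ => Finset.sum_comm
    _ = ∑ x, ∑ x', ∑ z, ∑ y, F x x' y z := Finset.sum_congr rfl fun x _ => Finset.sum_comm

theorem sum_sum_sq_sum (F : X → Y → Z → ℤ) :
    ∑ y, ∑ z, (∑ x, F x y z) ^ 2 = ∑ x, ∑ x', ∑ z, ∑ y, F x y z * F x' y z := by
  simp only [sq, Finset.sum_mul_sum]
  exact sum_sum_sum_sum_comm fun x x' y z => F x y z * F x' y z

/-- The sum of a kernel over a cylinder intersection is bounded by its box norm. -/
theorem sum_cylinder_pow_four_le (f : Y → Z → ℤ) (g : X → Z → ℤ) (h : X → Y → ℤ)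
    (hf : ∀ y z, |f y z| ≤ 1) (hg : ∀ x z, |g x z| ≤ 1) (hh : ∀ x y, |h x y| ≤ 1)
    (k : X → Y → Z → ℤ) :
    (∑ x, ∑ y, ∑ z, f y z * g x z * h x y * k x y z) ^ 4 ≤
      (Fintype.card X) ^ 2 * (Fintype.card Y) ^ 2 * (Fintype.card Z) ^ 3 *
        ∑ x, ∑ x', ∑ y, ∑ y', |∑ z, k x y z * k x' y z * (k x y' z * k x' y' z)| := by
  set S := ∑ x, ∑ y, ∑ z, f y z * g x z * h x y * k x y z with hS
  set T := ∑ q : X × X × Z, (g q.1 q.2.2 * g q.2.1 q.2.2) *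
    ∑ y, h q.1 y * h q.2.1 y * (k q.1 y q.2.2 * k q.2.1 y q.2.2) with hT
  -- Cauchy–Schwarz over `(y, z)` removes `f` and duplicates `x`.
  have hS2 : S ^ 2 ≤ (Fintype.card Y * Fintype.card Z) * T := by
    have e1 : S = ∑ p : Y × Z, f p.1 p.2 * ∑ x, g x p.2 * h x p.1 * k x p.1 p.2 := by
      rw [hS, Fintype.sum_prod_type, Finset.sum_comm]
      refine Finset.sum_congr rfl fun y _ => ?_
      rw [Finset.sum_comm]
      refine Finset.sum_congr rfl fun z _ => ?_
      rw [Finset.mul_sum]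
      exact Finset.sum_congr rfl fun x _ => by ring
    have e2 : T = ∑ p : Y × Z, (∑ x, g x p.2 * h x p.1 * k x p.1 p.2) ^ 2 := by
      rw [hT, Fintype.sum_prod_type, Fintype.sum_prod_type]
      rw [sum_sum_sq_sum fun x y z => g x z * h x y * k x y z]
      refine Finset.sum_congr rfl fun x _ => ?_
      rw [Fintype.sum_prod_type]
      refine Finset.sum_congr rfl fun x' _ => Finset.sum_congr rfl fun z _ => ?_
      rw [Finset.mul_sum]
      exact Finset.sum_congr rfl fun y _ => by ring
    rw [e1, e2]
    have := sq_sum_mul_le_card_mul_sum_sq (fun p : Y × Z => f p.1 p.2)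
      (fun p => ∑ x, g x p.2 * h x p.1 * k x p.1 p.2) (fun p => hf _ _)
    simpa [Fintype.card_prod] using this
  -- Cauchy–Schwarz over `(x, x', z)` removes `g` and duplicates `y`. The remaining `h` factors do
  -- not involve `z`, so they leave the inner sum and are bounded by `1`.
  have hT2 : T ^ 2 ≤ (Fintype.card X ^ 2 * Fintype.card Z) *
      ∑ x, ∑ x', ∑ y, ∑ y', |∑ z, k x y z * k x' y z * (k x y' z * k x' y' z)| := by
    have h1 := sq_sum_mul_le_card_mul_sum_sq
      (fun q : X × X × Z => g q.1 q.2.2 * g q.2.1 q.2.2)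
      (fun q => ∑ y, h q.1 y * h q.2.1 y * (k q.1 y q.2.2 * k q.2.1 y q.2.2))
      (fun q => by
        rw [abs_mul]; exact mul_le_one₀ (hg _ _) (abs_nonneg _) (hg _ _))
    refine h1.trans ?_
    have hc : (Fintype.card (X × X × Z) : ℤ) = Fintype.card X ^ 2 * Fintype.card Z := by
      simp only [Fintype.card_prod]; push_cast; ring
    rw [hc]
    gcongr
    simp only [Fintype.sum_prod_type]
    refine Finset.sum_le_sum fun x _ => Finset.sum_le_sum fun x' _ => ?_
    have e0 : ∑ z, (∑ y, h x y * h x' y * (k x y z * k x' y z)) ^ 2 =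
        ∑ y, ∑ y', ∑ z, h x y * h x' y * (k x y z * k x' y z) *
          (h x y' * h x' y' * (k x y' z * k x' y' z)) := by
      have := sum_sum_sq_sum (Y := Unit) fun y (_ : Unit) z =>
        h x y * h x' y * (k x y z * k x' y z)
      simpa only [Finset.univ_unique, Finset.sum_singleton] using this
    rw [e0]
    refine Finset.sum_le_sum fun y _ => Finset.sum_le_sum fun y' _ => ?_
    have e : ∑ z, h x y * h x' y * (k x y z * k x' y z) *
        (h x y' * h x' y' * (k x y' z * k x' y' z)) =
        (h x y * h x' y * (h x y' * h x' y')) *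
          ∑ z, k x y z * k x' y z * (k x y' z * k x' y' z) := by
      rw [Finset.mul_sum]
      exact Finset.sum_congr rfl fun z _ => by ring
    rw [e]
    refine (le_abs_self _).trans ?_
    rw [abs_mul]
    refine mul_le_of_le_one_left (abs_nonneg _) ?_
    simp only [abs_mul]
    exact mul_le_one₀ (mul_le_one₀ (hh _ _) (abs_nonneg _) (hh _ _)) (by positivity)
      (mul_le_one₀ (hh _ _) (abs_nonneg _) (hh _ _))
  calc S ^ 4 = (S ^ 2) ^ 2 := by ring
    _ ≤ ((Fintype.card Y * Fintype.card Z) * T) ^ 2 := by gcongr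
    _ = (Fintype.card Y * Fintype.card Z) ^ 2 * T ^ 2 := by ring
    _ ≤ (Fintype.card Y * Fintype.card Z) ^ 2 * _ :=
      mul_le_mul_of_nonneg_left hT2 (sq_nonneg _)
    _ = _ := by ring

end CylinderIntersections

/-! ### Lower bound for three-party set disjointness. -/

section Disjointness

variable {ι : Type*} [Fintype ι]

theorem sum_pi_prod [DecidableEq ι] {α : Type*} [Fintype α] (φ : ι → α → ℤ) :
    ∑ x : ι → α, ∏ i, φ i (x i) = ∏ i, ∑ a, φ i a := by
  rw [Finset.prod_univ_sum, Fintype.piFinset_univ]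

/-- Three sets have no common element; the first two are coded with letters in `Fin 4`, where `0`
stands for membership, so that a uniformly random set has density `1/4`. -/
def NoCommon (x y : ι → Fin 4) (z : ι → Bool) : Prop :=
  ∀ i, ¬ (x i = 0 ∧ y i = 0 ∧ z i = true)

instance (x y : ι → Fin 4) (z : ι → Bool) : Decidable (NoCommon x y z) := by
  unfold NoCommon; infer_instance

/-- The sign that is negative at a common element. -/
def commonSign (a b : Fin 4) (c : Bool) : ℤ := if a = 0 ∧ b = 0 ∧ c = true then -1 else 1

theorem prod_commonSign_of_noCommon {x y : ι → Fin 4} {z : ι → Bool} (h : NoCommon x y z) :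
    ∏ i, commonSign (x i) (y i) (z i) = 1 :=
  Finset.prod_eq_one fun i _ => if_neg (h i)

/-- The sum over `c` vanishes when exactly one of `a, a'` and exactly one of `b, b'` is `0`, which
is `36` of `256` cases; it is `2` in the other `220`. The density `1/4` matters: the argument needs
`31 ^ 4 = 923521` to exceed `4 ^ 2 * 4 ^ 2 * 2 ^ 3 * 440 = 901120`, whereas density `1/2` would give
`7 ^ 4 = 2401` against `3072`. -/
theorem boxNorm_commonSign :
    ∑ a : Fin 4, ∑ a' : Fin 4, ∑ b : Fin 4, ∑ b' : Fin 4,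
      |∑ c : Bool, commonSign a b c * commonSign a' b c *
        (commonSign a b' c * commonSign a' b' c)| = 440 := by
  decide +kernel

variable [DecidableEq ι]

theorem boxNorm_prod_commonSign :
    ∑ x : ι → Fin 4, ∑ x' : ι → Fin 4, ∑ y : ι → Fin 4, ∑ y' : ι → Fin 4,
      |∑ z : ι → Bool, (∏ i, commonSign (x i) (y i) (z i)) *
        (∏ i, commonSign (x' i) (y i) (z i)) * ((∏ i, commonSign (x i) (y' i) (z i)) *
        (∏ i, commonSign (x' i) (y' i) (z i)))| = 440 ^ Fintype.card ι := by
  simp only [← Finset.prod_mul_distrib]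
  have h0 : ∀ x x' y y' : ι → Fin 4,
      |∑ z : ι → Bool, ∏ i, commonSign (x i) (y i) (z i) * commonSign (x' i) (y i) (z i) *
        (commonSign (x i) (y' i) (z i) * commonSign (x' i) (y' i) (z i))| =
      ∏ i, |∑ c : Bool, commonSign (x i) (y i) c * commonSign (x' i) (y i) c *
        (commonSign (x i) (y' i) c * commonSign (x' i) (y' i) c)| := by
    intro x x' y y'
    rw [sum_pi_prod (fun i c => commonSign (x i) (y i) c * commonSign (x' i) (y i) c *
        (commonSign (x i) (y' i) c * commonSign (x' i) (y' i) c)), Finset.abs_prod]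
  simp only [h0]
  let ψ : Fin 4 → Fin 4 → Fin 4 → Fin 4 → ℤ := fun a a' b b' =>
    |∑ c : Bool, commonSign a b c * commonSign a' b c *
      (commonSign a b' c * commonSign a' b' c)|
  have h1 : ∀ x x' y : ι → Fin 4, ∑ y' : ι → Fin 4, ∏ i, ψ (x i) (x' i) (y i) (y' i) =
      ∏ i, ∑ b', ψ (x i) (x' i) (y i) b' := fun x x' y =>
    sum_pi_prod fun i b' => ψ (x i) (x' i) (y i) b'
  have h2 : ∀ x x' : ι → Fin 4, ∑ y : ι → Fin 4, ∏ i, ∑ b', ψ (x i) (x' i) (y i) b' =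
      ∏ i, ∑ b, ∑ b', ψ (x i) (x' i) b b' := fun x x' =>
    sum_pi_prod fun i b => ∑ b', ψ (x i) (x' i) b b'
  have h3 : ∀ x : ι → Fin 4, ∑ x' : ι → Fin 4, ∏ i, ∑ b, ∑ b', ψ (x i) (x' i) b b' =
      ∏ i, ∑ a', ∑ b, ∑ b', ψ (x i) a' b b' := fun x =>
    sum_pi_prod fun i a' => ∑ b, ∑ b', ψ (x i) a' b b'
  have h4 : ∑ x : ι → Fin 4, ∏ i, ∑ a', ∑ b, ∑ b', ψ (x i) a' b b' =
      ∏ i : ι, ∑ a, ∑ a', ∑ b, ∑ b', ψ a a' b b' :=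
    sum_pi_prod fun _ a => ∑ a', ∑ b, ∑ b', ψ a a' b b'
  change ∑ x : ι → Fin 4, ∑ x' : ι → Fin 4, ∑ y : ι → Fin 4, ∑ y' : ι → Fin 4,
    ∏ i, ψ (x i) (x' i) (y i) (y' i) = _
  simp only [h1, h2, h3, h4]
  rw [Finset.prod_const, Finset.card_univ]
  exact congrArg (· ^ Fintype.card ι) boxNorm_commonSign

/-- A cylinder intersection that contains only triples without common element is small. -/
theorem card_cylinder_pow_four_le (S : (ι → Fin 4) → (ι → Fin 4) → (ι → Bool) → Prop)
    [∀ x y z, Decidable (S x y z)]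
    (hS : ∀ x y z, S x y z → NoCommon x y z)
    (hcyl : ∀ x y z x' y' z', S x' y z → S x y' z → S x y z' → S x y z) :
    (∑ x, ∑ y, ∑ z, if S x y z then (1 : ℤ) else 0) ^ 4 ≤ 901120 ^ Fintype.card ι := by
  classical
  -- Indicators of the three projections of `S`; by `hcyl` their product is the indicator of `S`,
  -- and the kernel is `1` there.
  let f : (ι → Fin 4) → (ι → Bool) → ℤ := fun y z => if ∃ x, S x y z then 1 else 0
  let g : (ι → Fin 4) → (ι → Bool) → ℤ := fun x z => if ∃ y, S x y z then 1 else 0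
  let h : (ι → Fin 4) → (ι → Fin 4) → ℤ := fun x y => if ∃ z, S x y z then 1 else 0
  have key := sum_cylinder_pow_four_le f g h
    (fun y z => by dsimp only [f]; split_ifs <;> simp)
    (fun y z => by dsimp only [g]; split_ifs <;> simp)
    (fun y z => by dsimp only [h]; split_ifs <;> simp)
    (fun x y z => ∏ i, commonSign (x i) (y i) (z i))
  rw [boxNorm_prod_commonSign] at key
  have e : ∀ x y z, (if S x y z then (1 : ℤ) else 0) =
      f y z * g x z * h x y * ∏ i, commonSign (x i) (y i) (z i) := by
    intro x y z
    by_cases hs : S x y z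
    · have h1 : f y z = 1 := if_pos ⟨x, hs⟩
      have h2 : g x z = 1 := if_pos ⟨y, hs⟩
      have h3 : h x y = 1 := if_pos ⟨z, hs⟩
      rw [if_pos hs, h1, h2, h3, prod_commonSign_of_noCommon (hS _ _ _ hs)]
      rfl
    · rw [if_neg hs]
      by_cases h1 : ∃ x', S x' y z
      · by_cases h2 : ∃ y', S x y' z
        · by_cases h3 : ∃ z', S x y z'
          · obtain ⟨x', h1⟩ := h1
            obtain ⟨y', h2⟩ := h2
            obtain ⟨z', h3⟩ := h3
            exact absurd (hcyl _ _ _ _ _ _ h1 h2 h3) hs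
          · have : h x y = 0 := if_neg h3
            rw [this]; ring
        · have : g x z = 0 := if_neg h2
          rw [this]; ring
      · have : f y z = 0 := if_neg h1
        rw [this]; ring
  simp only [e]
  refine key.trans (le_of_eq ?_)
  simp only [Fintype.card_pi, Fintype.card_fin, Fintype.card_bool, Finset.prod_const,
    Finset.card_univ]
  push_cast
  simp only [← pow_mul, mul_comm (Fintype.card ι)]
  simp only [pow_mul, ← mul_pow]
  norm_num

/-- Coordinates are independent, and each excludes one of the `4 * 4 * 2 = 32` letter triples. -/
theorem sum_noCommon :
    ∑ x : ι → Fin 4, ∑ y : ι → Fin 4, ∑ z : ι → Bool, (if NoCommon x y z then (1 : ℤ) else 0) =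
      31 ^ Fintype.card ι := by
  let φ : Fin 4 → Fin 4 → Bool → ℤ := fun a b c => if a = 0 ∧ b = 0 ∧ c = true then 0 else 1
  have h0 : ∀ (x y : ι → Fin 4) (z : ι → Bool), (if NoCommon x y z then (1 : ℤ) else 0) =
      ∏ i, φ (x i) (y i) (z i) := by
    intro x y z
    split_ifs with h
    · exact (Finset.prod_eq_one fun i _ => if_neg (h i)).symm
    · simp only [NoCommon, not_forall, not_not] at h
      obtain ⟨i, hi⟩ := h
      exact (Finset.prod_eq_zero (f := fun i => φ (x i) (y i) (z i))
        (Finset.mem_univ i) (if_pos hi)).symm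
  have h1 : ∀ x y : ι → Fin 4, ∑ z : ι → Bool, ∏ i, φ (x i) (y i) (z i) =
      ∏ i, ∑ c, φ (x i) (y i) c := fun x y => sum_pi_prod fun i c => φ (x i) (y i) c
  have h2 : ∀ x : ι → Fin 4, ∑ y : ι → Fin 4, ∏ i, ∑ c, φ (x i) (y i) c =
      ∏ i, ∑ b, ∑ c, φ (x i) b c := fun x => sum_pi_prod fun i b => ∑ c, φ (x i) b c
  have h3 : ∑ x : ι → Fin 4, ∏ i, ∑ b, ∑ c, φ (x i) b c = ∏ i : ι, ∑ a, ∑ b, ∑ c, φ a b c :=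
    sum_pi_prod fun _ a => ∑ b, ∑ c, φ a b c
  simp only [h0, h1, h2, h3]
  rw [Finset.prod_const, Finset.card_univ]
  exact congrArg (· ^ Fintype.card ι) (by decide +kernel : ∑ a, ∑ b, ∑ c, φ a b c = 31)

/-- A three-party protocol for disjointness, given as a colouring of the inputs by transcripts,
uses exponentially many colours. -/
theorem card_le_of_coloring {κ : Type*} [Fintype κ]
    (col : (ι → Fin 4) → (ι → Fin 4) → (ι → Bool) → κ)
    (hcol : ∀ x y z x' y' z', NoCommon x' y z → NoCommon x y' z → NoCommon x y z' →
      col x' y z = col x y' z → col x y' z = col x y z' →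
        NoCommon x y z ∧ col x y z = col x y z') :
    923521 ^ Fintype.card ι ≤ Fintype.card κ ^ 4 * 901120 ^ Fintype.card ι := by
  classical
  let cnt : κ → ℤ := fun q => ∑ x, ∑ y, ∑ z,
    if NoCommon x y z ∧ col x y z = q then (1 : ℤ) else 0
  have hcnt : ∀ q, cnt q ^ 4 ≤ 901120 ^ Fintype.card ι := by
    intro q
    refine card_cylinder_pow_four_le (fun x y z => NoCommon x y z ∧ col x y z = q)
      (fun x y z h => h.1) ?_
    rintro x y z x' y' z' ⟨h1, c1⟩ ⟨h2, c2⟩ ⟨h3, c3⟩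
    obtain ⟨h4, c4⟩ := hcol x y z x' y' z' h1 h2 h3 (c1.trans c2.symm) (c2.trans c3.symm)
    exact ⟨h4, c4.trans c3⟩
  have hsum : ∑ q, cnt q = 31 ^ Fintype.card ι := by
    rw [← sum_noCommon]
    simp only [cnt]
    rw [Finset.sum_comm]
    refine Finset.sum_congr rfl fun x _ => ?_
    rw [Finset.sum_comm]
    refine Finset.sum_congr rfl fun y _ => ?_
    rw [Finset.sum_comm]
    refine Finset.sum_congr rfl fun z _ => ?_
    by_cases h : NoCommon x y z <;> simp [h]
  -- Power mean inequality, by Cauchy–Schwarz twice.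
  have hpow : (∑ q, cnt q) ^ 4 ≤ (Fintype.card κ : ℤ) ^ 3 * ∑ q, cnt q ^ 4 := by
    have h1 := sq_sum_le_card_mul_sum_sq (s := Finset.univ) (f := cnt)
    have h2 := sq_sum_le_card_mul_sum_sq (s := Finset.univ) (f := fun q => cnt q ^ 2)
    simp only [Finset.card_univ, ← pow_mul] at h1 h2
    calc (∑ q, cnt q) ^ 4 = ((∑ q, cnt q) ^ 2) ^ 2 := by ring
      _ ≤ (Fintype.card κ * ∑ q, cnt q ^ 2) ^ 2 := by gcongr
      _ = (Fintype.card κ : ℤ) ^ 2 * (∑ q, cnt q ^ 2) ^ 2 := by ring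
      _ ≤ (Fintype.card κ : ℤ) ^ 2 * (Fintype.card κ * ∑ q, cnt q ^ (2 * 2)) := by gcongr
      _ = _ := by norm_num; ring
  have hle : ∑ q, cnt q ^ 4 ≤ Fintype.card κ * 901120 ^ Fintype.card ι := by
    simpa using Finset.sum_le_card_nsmul Finset.univ _ _ fun q _ => hcnt q
  rw [hsum, ← pow_mul, mul_comm, pow_mul] at hpow
  have hfin : (923521 : ℤ) ^ Fintype.card ι ≤
      (Fintype.card κ : ℤ) ^ 4 * 901120 ^ Fintype.card ι := by
    calc (923521 : ℤ) ^ Fintype.card ι = (31 ^ 4) ^ Fintype.card ι := by norm_num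
      _ ≤ _ := hpow
      _ ≤ (Fintype.card κ : ℤ) ^ 3 * (Fintype.card κ * 901120 ^ Fintype.card ι) := by gcongr
      _ = _ := by ring
  exact_mod_cast hfin

/-- Since `2 * 901120 ^ 29 ≤ 923521 ^ 29`, raising the previous bound to the power `29` gives the
constant `116 = 4 * 29`. -/
theorem card_le_of_coloring_bits {κ : Type*} [Fintype κ] {K : ℕ} (hK : Fintype.card κ ≤ 2 ^ K)
    (col : (ι → Fin 4) → (ι → Fin 4) → (ι → Bool) → κ)
    (hcol : ∀ x y z x' y' z', NoCommon x' y z → NoCommon x y' z → NoCommon x y z' →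
      col x' y z = col x y' z → col x y' z = col x y z' →
        NoCommon x y z ∧ col x y z = col x y z') :
    Fintype.card ι ≤ 116 * K := by
  have h := card_le_of_coloring col hcol
  set M := Fintype.card ι
  have h1 : 923521 ^ M ≤ 2 ^ (4 * K) * 901120 ^ M := by
    refine h.trans ?_
    refine Nat.mul_le_mul_right _ ?_
    calc Fintype.card κ ^ 4 ≤ (2 ^ K) ^ 4 := by gcongr
      _ = 2 ^ (4 * K) := by rw [← pow_mul, mul_comm]
  have h2 : 2 ^ M * (901120 ^ M) ^ 29 ≤ 2 ^ (116 * K) * (901120 ^ M) ^ 29 := by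
    calc 2 ^ M * (901120 ^ M) ^ 29 = (2 * 901120 ^ 29) ^ M := by
          rw [mul_pow, ← pow_mul, ← pow_mul, mul_comm 29]
      _ ≤ (923521 ^ 29) ^ M := by gcongr; norm_num
      _ = (923521 ^ M) ^ 29 := by rw [← pow_mul, ← pow_mul, mul_comm]
      _ ≤ (2 ^ (4 * K) * 901120 ^ M) ^ 29 := by gcongr
      _ = _ := by rw [mul_pow, ← pow_mul]; congr 2; ring
  have h3 : 2 ^ M ≤ 2 ^ (116 * K) := Nat.le_of_mul_le_mul_right h2 (by positivity)
  exact (Nat.pow_le_pow_iff_right (by norm_num)).1 h3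

end Disjointness

/-! ### Indistinguishability in LOCAL. -/

section Local

/-- A graph as a network without labels. -/
abbrev unlabeled {V : Type} [Fintype V] [Nonempty V] (G : SimpleGraph V) : LabeledGraph :=
  { V := V, graph := G, label := fun _ => [] }

variable {V : Type} [Fintype V] [Nonempty V]

theorem mem_nbrs (G : LabeledGraph) (v u : G.V) : u ∈ G.nbrs v ↔ G.graph.Adj v u := by
  simp [LabeledGraph.nbrs]

theorem nbrs_unlabeled_congr {G H : SimpleGraph V} {v : V}
    (h : ∀ u, G.Adj v u ↔ H.Adj v u) : (unlabeled G).nbrs v = (unlabeled H).nbrs v := by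
  ext u
  rw [mem_nbrs, mem_nbrs]
  exact h u

theorem run_concat (A : DistAlgorithm) (G : LabeledGraph) (ident : G.V → ℕ) (s : ℕ)
    (r : RoundKind) :
    A.run G ident (List.replicate (s + 1) r) =
      A.step G ident (A.run G ident (List.replicate s r)) r := by
  rw [List.replicate_succ', DistAlgorithm.run, List.foldl_append]
  rfl

theorem start_unlabeled_congr (A : DistAlgorithm) {G H : SimpleGraph V} (ident : V → ℕ) {v : V}
    (h : ∀ u, G.Adj v u ↔ H.Adj v u) :
    A.start (unlabeled G) ident v = A.start (unlabeled H) ident v := by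
  have := nbrs_unlabeled_congr h
  unfold DistAlgorithm.start
  rw [this]
  rfl

/-- In LOCAL, the states on a union of components depend only on these components. -/
theorem run_loc_congr (A : DistAlgorithm) {G H : SimpleGraph V} (ident : V → ℕ) (S : Set V)
    (hS : ∀ v ∈ S, ∀ u, G.Adj v u → u ∈ S) (h : ∀ v ∈ S, ∀ u, G.Adj v u ↔ H.Adj v u) (t : ℕ) :
    ∀ v ∈ S, A.run (unlabeled G) ident (List.replicate t .loc) v =
      A.run (unlabeled H) ident (List.replicate t .loc) v := by
  induction t with
  | zero => exact fun v hv => start_unlabeled_congr A ident (h v hv)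
  | succ t ih =>
    intro v hv
    rw [run_concat, run_concat]
    unfold DistAlgorithm.step
    rw [ih v hv]
    congr 1
    unfold DistAlgorithm.received
    have e := nbrs_unlabeled_congr (h v hv)
    dsimp only
    rw [← e]
    refine Finset.image_congr fun u hu => ?_
    have hu' : G.Adj v u := (mem_nbrs (unlabeled G) v u).1 hu
    simp only [ih u (hS v hv u hu')]

/-- Identifiers `1, …, n`. -/
noncomputable def enumIdent (V : Type) [Fintype V] (v : V) : ℕ := Fintype.equivFin V v + 1

theorem isIdAssignment_enumIdent {N : ℕ → ℕ} (hN : ∀ n, n ≤ N n) (G : SimpleGraph V) :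
    (unlabeled G).IsIdAssignment N (enumIdent V) := by
  refine ⟨fun u v h => ?_, fun v => ⟨Nat.succ_pos _, ?_⟩⟩
  · have : (Fintype.equivFin V u : ℕ) = Fintype.equivFin V v := Nat.succ_injective h
    exact (Fintype.equivFin V).injective (Fin.ext this)
  · exact (Nat.succ_le_of_lt (Fintype.equivFin V v).2).trans (hN _)

theorem mem_TOMDF_of_cliqueFree {G : SimpleGraph V} (h : G.CliqueFree 3) :
    unlabeled G ∈ TOMDF := fun T hT => absurd hT (h T)

/-- A triangle on `0, 1, 2`, and four isolated vertices. -/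
def isolatedTriangle : SimpleGraph (Fin 7) where
  Adj u v := u ≠ v ∧ u.val < 3 ∧ v.val < 3
  symm := ⟨fun _ _ h => ⟨h.1.symm, h.2.2, h.2.1⟩⟩
  loopless := ⟨fun _ h => h.1 rfl⟩

/-- A triangle on `0, 1, 2`, and a star with three leaves centred at `3`. -/
def triangleWithStar : SimpleGraph (Fin 7) where
  Adj u v := u ≠ v ∧ (u.val < 3 ∧ v.val < 3 ∨ u.val = 3 ∧ 3 ≤ v.val ∨ v.val = 3 ∧ 3 ≤ u.val)
  symm := ⟨fun _ _ h => ⟨h.1.symm, by tauto⟩⟩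
  loopless := ⟨fun _ h => h.1 rfl⟩

instance : DecidableRel isolatedTriangle.Adj := fun u v =>
  inferInstanceAs (Decidable (u ≠ v ∧ u.val < 3 ∧ v.val < 3))

instance : DecidableRel triangleWithStar.Adj := fun u v =>
  inferInstanceAs (Decidable (u ≠ v ∧
    (u.val < 3 ∧ v.val < 3 ∨ u.val = 3 ∧ 3 ≤ v.val ∨ v.val = 3 ∧ 3 ≤ u.val)))

theorem isolatedTriangle_notMem : unlabeled isolatedTriangle ∉ TOMDF := by
  classical
  intro h
  have hT : isolatedTriangle.IsNClique 3 {0, 1, 2} := by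
    rw [SimpleGraph.is3Clique_triple_iff]
    simp [isolatedTriangle]
  have h1 := h {0, 1, 2} (by convert hT) 0 (by simp)
  have hd : ∀ v : Fin 7, isolatedTriangle.degree v ≤ isolatedTriangle.degree 0 := by
    decide
  exact absurd (SimpleGraph.maxDegree_le_of_forall_degree_le _ _ hd) (by
    have h2 : isolatedTriangle.degree 0 < isolatedTriangle.maxDegree := by convert h1
    omega)

theorem triangleWithStar_mem : unlabeled triangleWithStar ∈ TOMDF := by
  classical
  intro T hT v hv
  have h3 : 3 ≤ triangleWithStar.maxDegree := by
    exact le_trans (by decide) (triangleWithStar.degree_le_maxDegree 3)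
  have h2 : triangleWithStar.degree v < 3 := by
    have hT' : triangleWithStar.IsNClique 3 T := by convert hT
    obtain ⟨a, b, c, hab, hac, hbc, rfl⟩ := SimpleGraph.is3Clique_iff.1 hT'
    have hlt : ∀ v : Fin 7, v.val < 3 → triangleWithStar.degree v < 3 := by
      decide
    apply hlt
    have hv' : v = a ∨ v = b ∨ v = c := by
      have := hv
      simpa using this
    simp only [triangleWithStar, ne_eq, Fin.ext_iff] at hab hac hbc
    rcases hv' with rfl | rfl | rfl <;> omega
  have h4 : triangleWithStar.degree v < triangleWithStar.maxDegree := by omega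
  convert h4

/-- All three networks have `7` vertices, since nodes know the size. In `isolatedTriangle` the
triangle nodes behave as in `triangleWithStar`, the others as in the empty graph, and both of these
networks are accepted. -/
theorem TOMDF_notMem_LStar {N : ℕ → ℕ} (hN : ∀ n, n ≤ N n) : TOMDF ∉ LStar N := by
  intro hL
  obtain ⟨t, A, c, hA⟩ := Set.mem_iUnion.1 hL
  have hdec := fun G : SimpleGraph (Fin 7) =>
    (hA (unlabeled G) (enumIdent (Fin 7)) (isIdAssignment_enumIdent hN G)).2
  refine isolatedTriangle_notMem ((hdec isolatedTriangle).2 fun v => ?_)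
  by_cases hv : v.val < 3
  · have hacc := (hdec triangleWithStar).1 triangleWithStar_mem v
    have e := run_loc_congr A (G := isolatedTriangle) (H := triangleWithStar)
      (enumIdent (Fin 7)) {v | v.val < 3} (fun v _ u h => h.2.2) (fun v hv u => by
        have hv' : v.val < 3 := hv
        simp only [isolatedTriangle, triangleWithStar]
        constructor
        · rintro ⟨h, h1, h2⟩
          exact ⟨h, Or.inl ⟨h1, h2⟩⟩
        · rintro ⟨h, h1⟩
          exact ⟨h, by omega⟩) t v hv
    rw [e]
    exact hacc
  · have hacc := (hdec ⊥).1 (mem_TOMDF_of_cliqueFree (SimpleGraph.cliqueFree_bot (by norm_num))) v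
    have e := run_loc_congr A (G := isolatedTriangle) (H := ⊥)
      (enumIdent (Fin 7)) {v | ¬ v.val < 3} (fun v hv u h => absurd h.2.1 hv) (fun v hv u => by
        have hv' : ¬ v.val < 3 := hv
        simp [isolatedTriangle, hv']) t v hv
    rw [e]
    exact hacc

end Local

/-! ### The algorithm with one BCC and one LOCAL round. -/

section BroadcastThenLocal

/-- An injective coding of finite sets of natural numbers by binary strings. -/
def encodeFinset (F : Finset ℕ) : List Bool := Nat.bits (Encodable.encode F)

theorem bits_injective : Function.Injective Nat.bits := fun a b h =>
  Nat.eq_of_testBit_eq fun i => by rw [Nat.testBit_eq_inth, Nat.testBit_eq_inth, h]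

theorem encodeFinset_injective : Function.Injective encodeFinset :=
  bits_injective.comp Encodable.encode_injective

/-- Broadcast the degree, then send the list of neighbours to all neighbours. A node rejects if its
degree is maximum and one of its neighbours shares a neighbour with it. The state is the
initial knowledge, with the messages received in the last round and in the round before. -/
def degreeThenNeighbors : DistAlgorithm where
  State := NodeInput × Finset (ℕ × List Bool) × Finset (ℕ × List Bool)
  init I := (I, ∅, ∅)
  bcast s := Nat.bits s.1.nbrIds.card
  send s _ := encodeFinset s.1.nbrIds
  update s R := (s.1, R, s.2.1)
  accept s := ¬ ((∀ p ∈ s.2.2, ∀ d : ℕ, p.2 = Nat.bits d → d ≤ s.1.nbrIds.card) ∧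
    ∃ p ∈ s.2.1, ∃ F : Finset ℕ, p.2 = encodeFinset F ∧ ∃ w ∈ F, w ∈ s.1.nbrIds)

theorem TOMDF_mem_ClassBL (N : ℕ → ℕ) : TOMDF ∈ ClassBL N := by
  classical
  -- The constant `1` suffices: a degree is below `n`, hence has at most `Nat.log 2 n + 1` binary
  -- digits.
  refine ⟨degreeThenNeighbors, 1, fun G ident hid => ?_⟩
  have hinj := hid.1
  have hnbrs : ∀ v, G.nbrs v = G.graph.neighborFinset v := by
    intro v; ext u; simp [mem_nbrs]
  have hcard : ∀ v, ((G.nbrs v).image ident).card = G.graph.degree v := by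
    intro v
    rw [Finset.card_image_of_injective _ hinj, hnbrs]
    rfl
  constructor
  · intro before after h v
    have hb : before = [] := by
      rcases before with _ | ⟨r, _ | ⟨r', l⟩⟩
      · rfl
      · simp at h
      · simp at h
    subst hb
    have e : degreeThenNeighbors.bcast (degreeThenNeighbors.run G ident [] v) =
        Nat.bits (G.graph.degree v) := congrArg Nat.bits (hcard v)
    rw [e, one_mul, Nat.size_eq_bits_len, Nat.size_le]
    exact (G.graph.degree_lt_card_verts v).trans (Nat.lt_pow_succ_log_self (by norm_num) _)
  · have hacc : ∀ v, degreeThenNeighbors.accept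
        (degreeThenNeighbors.run G ident [.bcc, .loc] v) ↔
        ¬ ((∀ u, G.graph.degree u ≤ G.graph.degree v) ∧
          ∃ u w, G.graph.Adj v u ∧ G.graph.Adj u w ∧ G.graph.Adj v w) := by
      intro v
      have e : degreeThenNeighbors.accept (degreeThenNeighbors.run G ident [.bcc, .loc] v) =
        ¬ ((∀ p ∈ Finset.univ.image fun u => (ident u, Nat.bits ((G.nbrs u).image ident).card),
            ∀ d : ℕ, p.2 = Nat.bits d → d ≤ ((G.nbrs v).image ident).card) ∧
          ∃ p ∈ (G.nbrs v).image fun u => (ident u, encodeFinset ((G.nbrs u).image ident)),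
            ∃ F : Finset ℕ, p.2 = encodeFinset F ∧ ∃ w ∈ F, w ∈ (G.nbrs v).image ident) := by
        unfold DistAlgorithm.run DistAlgorithm.step DistAlgorithm.received
        simp only [List.foldl]
        unfold DistAlgorithm.start degreeThenNeighbors
        congr!
      rw [e]
      simp only [hcard]
      refine not_congr (and_congr ?_ ?_)
      · constructor
        · intro h u
          exact h _ (Finset.mem_image_of_mem _ (Finset.mem_univ u)) _ rfl
        · intro h p hp d hd
          obtain ⟨u, -, rfl⟩ := Finset.mem_image.1 hp
          rw [← bits_injective hd]
          exact h u
      · constructor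
        · rintro ⟨p, hp, F, hF, w, hw, hwv⟩
          obtain ⟨u, hu, rfl⟩ := Finset.mem_image.1 hp
          rw [← encodeFinset_injective hF] at hw
          obtain ⟨w', hw', rfl⟩ := Finset.mem_image.1 hw
          rw [hinj.mem_finset_image] at hwv
          rw [mem_nbrs] at hu hw' hwv
          exact ⟨u, w', hu, hw', hwv⟩
        · rintro ⟨u, w, hu, hw, hv⟩
          rw [← mem_nbrs] at hu hw hv
          exact ⟨_, Finset.mem_image_of_mem _ hu, _, rfl, _, Finset.mem_image_of_mem _ hw,
            Finset.mem_image_of_mem _ hv⟩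
    simp only [hacc]
    constructor
    · rintro hG v ⟨hmax, u, w, hu, huw, hw⟩
      have h1 := hG {v, u, w} (SimpleGraph.is3Clique_triple_iff.2 ⟨hu, hw, huw⟩) v (by simp)
      have h2 := SimpleGraph.maxDegree_le_of_forall_degree_le _ _ hmax
      have h3 : G.graph.degree v < G.graph.maxDegree := by convert h1
      omega
    · intro h T hT v hv
      by_contra hlt
      have hlt' : ¬ G.graph.degree v < G.graph.maxDegree := by
        intro h3
        apply hlt
        convert h3
      refine h v ⟨fun u => (G.graph.degree_le_maxDegree u).trans (not_lt.1 hlt'), ?_⟩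
      obtain ⟨a, b, c, hab, hac, hbc, rfl⟩ := SimpleGraph.is3Clique_iff.1 hT
      have hv' : v = a ∨ v = b ∨ v = c := by simpa using hv
      rcases hv' with rfl | rfl | rfl
      · exact ⟨b, c, hab, hbc, hac⟩
      · exact ⟨a, c, hab.symm, hac, hbc⟩
      · exact ⟨a, b, hac.symm, hab, hbc.symm⟩

end BroadcastThenLocal

/-! ### Pasting and transcripts in BCC. -/

section Broadcast

variable {V : Type} [Fintype V] [Nonempty V]

/-- If every node has the neighbourhood that it has in some network of a family of networks with
the same broadcasts, then its state is the same as in that network. -/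
theorem run_bcc_paste (A : DistAlgorithm) (ident : V → ℕ) (G : SimpleGraph V)
    (H : V → SimpleGraph V) (hN : ∀ v u, G.Adj v u ↔ (H v).Adj v u) (t : ℕ)
    (hτ : ∀ s < t, ∀ v v' w, A.bcast (A.run (unlabeled (H v)) ident (List.replicate s .bcc) w) =
      A.bcast (A.run (unlabeled (H v')) ident (List.replicate s .bcc) w)) :
    ∀ s ≤ t, ∀ v, A.run (unlabeled G) ident (List.replicate s .bcc) v =
      A.run (unlabeled (H v)) ident (List.replicate s .bcc) v := by
  intro s
  induction s with
  | zero => exact fun _ v => start_unlabeled_congr A ident (hN v)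
  | succ s ih =>
    intro hs v
    rw [run_concat, run_concat]
    unfold DistAlgorithm.step
    rw [ih (by omega) v]
    congr 1
    unfold DistAlgorithm.received
    dsimp only
    refine Finset.image_congr fun u _ => ?_
    simp only [ih (by omega) u]
    -- Node `u` broadcasts as in `H u`, which is also what it broadcasts in `H v`.
    rw [hτ s (by omega) u v u]

/-- Binary strings of length at most `b`. -/
abbrev ShortString (b : ℕ) : Type := Σ i : Fin (b + 1), List.Vector Bool i

theorem card_shortString_le (b : ℕ) : Fintype.card (ShortString b) ≤ 2 ^ (b + 1) := by
  rw [Fintype.card_sigma]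
  simp only [card_vector, Fintype.card_bool]
  rw [Fin.sum_univ_eq_sum_range (fun i => 2 ^ i) (b + 1)]
  have := Nat.geomSum_eq (le_refl 2) (b + 1)
  rw [this]
  simp

/-- Truncation of a string to length at most `b`. -/
def truncateString (b : ℕ) (l : List Bool) : ShortString b :=
  ⟨⟨(l.take b).length, Nat.lt_succ_of_le (List.length_take_le _ _)⟩, l.take b, rfl⟩

/-- Truncation only serves to make transcripts a finite type; nothing is lost on messages within the
bandwidth. -/
theorem truncateString_injOn {b : ℕ} {l l' : List Bool} (hl : l.length ≤ b)
    (hl' : l'.length ≤ b) (h : truncateString b l = truncateString b l') : l = l' := by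
  have h1 : ∀ q q' : ShortString b, q = q' → q.2.1 = q'.2.1 := by
    rintro q _ rfl
    rfl
  have h2 := h1 _ _ h
  simp only [truncateString] at h2
  rwa [List.take_of_length_le hl, List.take_of_length_le hl'] at h2

end Broadcast

/-! ### The cube instances and the lower bound for BCC. -/

section TriangleGadget

/-- The vertices of the hard instances: three families indexed by the faces of a cube, two of them
with twins. -/
inductive FaceVertex (m : ℕ) : Type where
  | a (u v : Fin m)
  | b (v w : Fin m)
  | b' (v w : Fin m)
  | c (u w : Fin m)
  | c' (u w : Fin m)

namespace FaceVertex

variable {m : ℕ}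

/-- Vertices as pairs of a type and a face position. -/
def equivProd (m : ℕ) : FaceVertex m ≃ Fin 5 × Fin m × Fin m where
  toFun
    | a u v => (0, u, v)
    | b u v => (1, u, v)
    | b' u v => (2, u, v)
    | c u v => (3, u, v)
    | c' u v => (4, u, v)
  invFun
    | (0, u, v) => a u v
    | (1, u, v) => b u v
    | (2, u, v) => b' u v
    | (3, u, v) => c u v
    | (4, u, v) => c' u v
  left_inv p := by cases p <;> rfl
  right_inv := by
    rintro ⟨i, u, v⟩
    fin_cases i <;> rfl

instance : Fintype (FaceVertex m) := Fintype.ofEquiv _ (equivProd m).symm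

instance : DecidableEq (FaceVertex m) := (equivProd m).decidableEq

instance [NeZero m] : Nonempty (FaceVertex m) := ⟨a 0 0⟩

theorem card_eq (m : ℕ) : Fintype.card (FaceVertex m) = 5 * m ^ 2 := by
  rw [Fintype.card_congr (equivProd m)]
  simp [sq]

end FaceVertex

open FaceVertex

variable {m : ℕ}

/-- The cells of the cube. -/
abbrev Cell (m : ℕ) : Type := Fin m × Fin m × Fin m

/-- The oriented edges of the hard instance given by three sets of cells. -/
inductive CubeArc (x y : Cell m → Fin 4) (z : Cell m → Bool) : FaceVertex m → FaceVertex m → Prop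
  | ab (u v w) : z (u, v, w) = true → CubeArc x y z (a u v) (b v w)
  | ab' (u v w) : z (u, v, w) = false → CubeArc x y z (a u v) (b' v w)
  | ac (u v w) : y (u, v, w) = 0 → CubeArc x y z (a u v) (c u w)
  | ac' (u v w) : y (u, v, w) ≠ 0 → CubeArc x y z (a u v) (c' u w)
  | bc (u v w) : x (u, v, w) = 0 → CubeArc x y z (b v w) (c u w)

/-- The hard instance given by three sets of cells. -/
def cubeGraph (x y : Cell m → Fin 4) (z : Cell m → Bool) : SimpleGraph (FaceVertex m) where
  Adj p q := CubeArc x y z p q ∨ CubeArc x y z q p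
  symm := ⟨fun _ _ h => h.symm⟩
  loopless := ⟨fun p h => by rcases h with h | h <;> cases h⟩

variable {x y x' y' : Cell m → Fin 4} {z z' : Cell m → Bool}

/-- No arc at a vertex `a u v` is governed by `x`; the next lemmas are the analogues for the other
families, blind to `y` or `z`. -/
theorem cubeGraph_adj_a (u v : Fin m) (q : FaceVertex m) :
    (cubeGraph x y z).Adj (a u v) q ↔ (cubeGraph x' y z).Adj (a u v) q := by
  constructor <;> rintro (h | h) <;> cases h
  all_goals first
    | exact Or.inl (.ab _ _ _ ‹_›) | exact Or.inl (.ab' _ _ _ ‹_›)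
    | exact Or.inl (.ac _ _ _ ‹_›) | exact Or.inl (.ac' _ _ _ ‹_›)

theorem cubeGraph_adj_b (v w : Fin m) (q : FaceVertex m) :
    (cubeGraph x y z).Adj (b v w) q ↔ (cubeGraph x y' z).Adj (b v w) q := by
  constructor <;> rintro (h | h) <;> cases h
  all_goals first
    | exact Or.inr (.ab _ _ _ ‹_›) | exact Or.inl (.bc _ _ _ ‹_›)

theorem cubeGraph_adj_b' (v w : Fin m) (q : FaceVertex m) :
    (cubeGraph x y z).Adj (b' v w) q ↔ (cubeGraph x y' z).Adj (b' v w) q := by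
  constructor <;> rintro (h | h) <;> cases h
  all_goals exact Or.inr (.ab' _ _ _ ‹_›)

theorem cubeGraph_adj_c (u w : Fin m) (q : FaceVertex m) :
    (cubeGraph x y z).Adj (c u w) q ↔ (cubeGraph x y z').Adj (c u w) q := by
  constructor <;> rintro (h | h) <;> cases h
  all_goals first
    | exact Or.inr (.ac _ _ _ ‹_›) | exact Or.inr (.bc _ _ _ ‹_›)

theorem cubeGraph_adj_c' (u w : Fin m) (q : FaceVertex m) :
    (cubeGraph x y z).Adj (c' u w) q ↔ (cubeGraph x y z').Adj (c' u w) q := by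
  constructor <;> rintro (h | h) <;> cases h
  all_goals exact Or.inr (.ac' _ _ _ ‹_›)

/-- The network in which a vertex has the same neighbourhood as in the network given by
`x, y, z`, among three that differ from it in one coordinate. -/
def pasteCubeGraph (x y x' y' : Cell m → Fin 4) (z z' : Cell m → Bool) :
    FaceVertex m → SimpleGraph (FaceVertex m)
  | a _ _ => cubeGraph x' y z
  | b _ _ => cubeGraph x y' z
  | b' _ _ => cubeGraph x y' z
  | c _ _ => cubeGraph x y z'
  | c' _ _ => cubeGraph x y z'

theorem cubeGraph_adj_iff_paste (p q : FaceVertex m) :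
    (cubeGraph x y z).Adj p q ↔ (pasteCubeGraph x y x' y' z z' p).Adj p q := by
  cases p
  · exact cubeGraph_adj_a _ _ _
  · exact cubeGraph_adj_b _ _ _
  · exact cubeGraph_adj_b' _ _ _
  · exact cubeGraph_adj_c _ _ _
  · exact cubeGraph_adj_c' _ _ _

/-- The twins `b'` and `c'` are adjacent to `a` vertices only, so a triangle has one vertex in each
of the families `a`, `b`, `c`; their shared indices determine a single cell. -/
theorem not_noCommon_of_triangle {p q r : FaceVertex m} (hpq : (cubeGraph x y z).Adj p q)
    (hpr : (cubeGraph x y z).Adj p r) (hqr : (cubeGraph x y z).Adj q r) : ¬ NoCommon x y z := by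
  intro h
  rcases hpq with hpq | hpq <;> cases hpq <;> rcases hpr with hpr | hpr <;> cases hpr <;>
    rcases hqr with hqr | hqr <;> cases hqr
  all_goals exact h _ ⟨‹_›, ‹_›, ‹_›⟩

theorem cubeGraph_mem_of_noCommon [NeZero m] (h : NoCommon x y z) :
    unlabeled (cubeGraph x y z) ∈ TOMDF := by
  classical
  refine mem_TOMDF_of_cliqueFree fun T hT => ?_
  obtain ⟨p, q, r, hpq, hpr, hqr, -⟩ := SimpleGraph.is3Clique_iff.1 hT
  exact not_noCommon_of_triangle hpq hpr hqr h

/-- A map whose values contain all neighbours of a vertex. -/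
def nbrMap (y : Cell m → Fin 4) (z : Cell m → Bool) : FaceVertex m → Fin m ⊕ Fin m → FaceVertex m
  | a u v, .inl w => if z (u, v, w) = true then b v w else b' v w
  | a u v, .inr w => if y (u, v, w) = 0 then c u w else c' u w
  | b v _, .inl u => a u v
  | b _ w, .inr u => c u w
  | b' v _, .inl u => a u v
  | b' v _, .inr u => a u v
  | c u _, .inl v => a u v
  | c _ w, .inr v => b v w
  | c' u _, .inl v => a u v
  | c' u _, .inr v => a u v

theorem exists_nbrMap_eq {p q : FaceVertex m} (h : (cubeGraph x y z).Adj p q) :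
    ∃ i, nbrMap y z p i = q := by
  rcases h with h | h
  · cases h with
    | ab u v w h => exact ⟨.inl w, if_pos h⟩
    | ab' u v w h => exact ⟨.inl w, if_neg (by simp [h])⟩
    | ac u v w h => exact ⟨.inr w, if_pos h⟩
    | ac' u v w h => exact ⟨.inr w, if_neg h⟩
    | bc u v w h => exact ⟨.inr u, rfl⟩
  · cases h with
    | ab u v w h => exact ⟨.inl u, rfl⟩
    | ab' u v w h => exact ⟨.inl u, rfl⟩
    | ac u v w h => exact ⟨.inl v, rfl⟩
    | ac' u v w h => exact ⟨.inl v, rfl⟩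
    | bc u v w h => exact ⟨.inr v, rfl⟩

/-- This is the role of the twins: whatever `y` and `z` are, `a u v` has one neighbour among `b v
w`, `b' v w` and one among `c u w`, `c' u w` for each `w`. -/
theorem adj_nbrMap_a (u v : Fin m) (i : Fin m ⊕ Fin m) :
    (cubeGraph x y z).Adj (a u v) (nbrMap y z (a u v) i) := by
  left
  rcases i with w | w
  · by_cases h : z (u, v, w) = true
    · have e : nbrMap y z (a u v) (.inl w) = b v w := if_pos h
      rw [e]; exact .ab _ _ _ h
    · have e : nbrMap y z (a u v) (.inl w) = b' v w := if_neg h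
      rw [e]; exact .ab' _ _ _ (by simpa using h)
  · by_cases h : y (u, v, w) = 0
    · have e : nbrMap y z (a u v) (.inr w) = c u w := if_pos h
      rw [e]; exact .ac _ _ _ h
    · have e : nbrMap y z (a u v) (.inr w) = c' u w := if_neg h
      rw [e]; exact .ac' _ _ _ h

theorem nbrMap_a_injective (u v : Fin m) : Function.Injective (nbrMap y z (a u v)) := by
  rintro (w | w) (w' | w') h <;> simp only [nbrMap] at h <;> split_ifs at h <;> cases h <;> rfl

/-- `nbrMap` bounds every degree by `2 * m`, and at `a u v` it is injective into the neighbours. -/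
theorem cubeGraph_degree_le (u v : Fin m) (p : FaceVertex m)
    [DecidableRel (cubeGraph x y z).Adj] :
    (cubeGraph x y z).degree p ≤ (cubeGraph x y z).degree (a u v) := by
  have h1 : (cubeGraph x y z).degree p ≤ Fintype.card (Fin m ⊕ Fin m) := by
    rw [SimpleGraph.degree, ← Finset.card_univ]
    refine (Finset.card_le_card fun q hq => ?_).trans
      (Finset.card_image_le (s := Finset.univ) (f := nbrMap y z p))
    obtain ⟨i, rfl⟩ := exists_nbrMap_eq ((SimpleGraph.mem_neighborFinset _ _ _).1 hq)
    exact Finset.mem_image_of_mem _ (Finset.mem_univ i)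
  refine h1.trans ?_
  rw [SimpleGraph.degree, ← Finset.card_univ,
    ← Finset.card_image_of_injective _ (nbrMap_a_injective (y := y) (z := z) u v)]
  refine Finset.card_le_card fun q hq => ?_
  obtain ⟨i, -, rfl⟩ := Finset.mem_image.1 hq
  exact (SimpleGraph.mem_neighborFinset _ _ _).2 (adj_nbrMap_a u v i)

theorem noCommon_of_cubeGraph_mem [NeZero m] (h : unlabeled (cubeGraph x y z) ∈ TOMDF) :
    NoCommon x y z := by
  classical
  rintro ⟨u, v, w⟩ ⟨hx, hy, hz⟩
  have hT : (cubeGraph x y z).IsNClique 3 {a u v, b v w, c u w} :=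
    SimpleGraph.is3Clique_triple_iff.2
      ⟨Or.inl (.ab _ _ _ hz), Or.inl (.ac _ _ _ hy), Or.inl (.bc _ _ _ hx)⟩
  have h1 := h {a u v, b v w, c u w} (by convert hT) (a u v) (by simp)
  have h2 : (cubeGraph x y z).degree (a u v) < (cubeGraph x y z).maxDegree := by convert h1
  have h3 := SimpleGraph.maxDegree_le_of_forall_degree_le _ _
    fun p => cubeGraph_degree_le (x := x) (y := y) (z := z) u v p
  omega

/-- A correct algorithm with `t` BCC rounds of bandwidth `b` satisfies a lower bound on `b t`. -/
theorem cube_le_of_decides [NeZero m] (A : DistAlgorithm) (ident : FaceVertex m → ℕ) (t β : ℕ)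
    (hband : ∀ G : SimpleGraph (FaceVertex m),
      A.BandwidthAtMost (unlabeled G) ident (List.replicate t .bcc) β)
    (hdec : ∀ G : SimpleGraph (FaceVertex m), unlabeled G ∈ TOMDF ↔
      ∀ v, A.accept (A.run (unlabeled G) ident (List.replicate t .bcc) v)) :
    m ^ 3 ≤ 116 * ((β + 1) * (t * (5 * m ^ 2))) := by
  classical
  have hlen : ∀ (G : SimpleGraph (FaceVertex m)), ∀ s < t, ∀ v,
      (A.bcast (A.run (unlabeled G) ident (List.replicate s .bcc) v)).length ≤ β := by
    intro G s hs v
    refine hband G (List.replicate s .bcc) (List.replicate (t - s - 1) .bcc) ?_ v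
    rw [← List.replicate_succ, ← List.replicate_add]
    congr 1
    omega
  let κ := Fin t → FaceVertex m → ShortString β
  have hκ : Fintype.card κ ≤ 2 ^ ((β + 1) * (t * (5 * m ^ 2))) := by
    have e : Fintype.card κ =
        (Fintype.card (ShortString β) ^ Fintype.card (FaceVertex m)) ^ t := by
      simp [κ]
    rw [e, card_eq]
    calc _ ≤ ((2 ^ (β + 1)) ^ (5 * m ^ 2)) ^ t := by
          gcongr; exact card_shortString_le β
      _ = _ := by rw [← pow_mul, ← pow_mul]; congr 1; ring
  let tr : SimpleGraph (FaceVertex m) → κ := fun G s v =>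
    truncateString β (A.bcast (A.run (unlabeled G) ident (List.replicate s .bcc) v))
  have htr : ∀ G H, tr G = tr H → ∀ s < t, ∀ v,
      A.bcast (A.run (unlabeled G) ident (List.replicate s .bcc) v) =
        A.bcast (A.run (unlabeled H) ident (List.replicate s .bcc) v) := by
    intro G H h s hs v
    exact truncateString_injOn (hlen G s hs v) (hlen H s hs v)
      (congrFun (congrFun h ⟨s, hs⟩) v)
  -- Inputs are coloured by the full broadcast transcript of their network.
  have key := card_le_of_coloring_bits (ι := Cell m) hκ (fun x y z => tr (cubeGraph x y z)) ?_
  · refine le_trans (le_of_eq ?_) key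
    simp [Cell]; ring
  intro x y z x' y' z' h1 h2 h3 e12 e23
  let P := pasteCubeGraph x y x' y' z z'
  have hP : ∀ v, tr (P v) = tr (cubeGraph x y z') := by
    intro v
    cases v
    · exact e12.trans e23
    · exact e23
    · exact e23
    · rfl
    · rfl
  have hrun := run_bcc_paste A ident (cubeGraph x y z) P cubeGraph_adj_iff_paste t
    (fun s hs v v' w => htr _ _ ((hP v).trans (hP v').symm) s hs w)
  have hmem : ∀ v, unlabeled (P v) ∈ TOMDF := by
    intro v
    cases v
    · exact cubeGraph_mem_of_noCommon h1
    · exact cubeGraph_mem_of_noCommon h2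
    · exact cubeGraph_mem_of_noCommon h2
    · exact cubeGraph_mem_of_noCommon h3
    · exact cubeGraph_mem_of_noCommon h3
  -- Every node ends in the state it has in its own network `P v`, where it accepts; so the pasted
  -- network is accepted, with the same transcript.
  refine ⟨noCommon_of_cubeGraph_mem ((hdec _).2 fun v => ?_), ?_⟩
  · rw [hrun t le_rfl v]
    exact (hdec _).1 (hmem v) v
  · funext s v
    change truncateString β _ = truncateString β _
    rw [hrun s s.2.le v]
    exact congrFun (congrFun (hP v) s) v

theorem TOMDF_notMem_BStar {N : ℕ → ℕ} (hN : ∀ n, n ≤ N n) : TOMDF ∉ BStar N := by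
  intro hB
  obtain ⟨t, A, c, hA⟩ := Set.mem_iUnion.1 hB
  -- Take `m = 2 ^ k` and cancel `m ^ 2`; `580 = 116 * 5`, and `5 * m ^ 2 ≤ 2 ^ (2 * k + 3)` bounds
  -- the logarithm.
  have hbound : ∀ k : ℕ, 2 ^ k ≤ 580 * t * (c * (2 * k + 4) + 1) := by
    intro k
    have : NeZero (2 ^ k) := ⟨by positivity⟩
    have h := cube_le_of_decides (m := 2 ^ k) A (enumIdent _) t
      (c * (Nat.log 2 (5 * (2 ^ k) ^ 2) + 1))
      (fun G => by
        have := (hA (unlabeled G) (enumIdent _) (isIdAssignment_enumIdent hN G)).1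
        rwa [LabeledGraph.size, card_eq] at this)
      (fun G => (hA (unlabeled G) (enumIdent _) (isIdAssignment_enumIdent hN G)).2)
    have hlog : Nat.log 2 (5 * (2 ^ k) ^ 2) ≤ 2 * k + 3 := by
      refine (Nat.log_mono_right ?_).trans (Nat.log_pow (by norm_num) (2 * k + 3)).le
      rw [← pow_mul, pow_add, mul_comm k 2]
      omega
    have h' : (2 ^ k) ^ 2 * 2 ^ k ≤ (2 ^ k) ^ 2 * (580 * t * (c * (2 * k + 4) + 1)) := by
      calc (2 ^ k) ^ 2 * 2 ^ k = (2 ^ k) ^ 3 := by ring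
        _ ≤ _ := h
        _ ≤ 116 * ((c * (2 * k + 3 + 1) + 1) * (t * (5 * (2 ^ k) ^ 2))) := by gcongr
        _ = _ := by ring
    exact Nat.le_of_mul_le_mul_left h' (by positivity)
  have hlim := tendsto_pow_const_div_const_pow_of_one_lt 1 (one_lt_two : (1 : ℝ) < 2)
  -- For `k ≥ 1` the right side of `hbound` is at most `D * k`, which `2 ^ k` eventually exceeds.
  set D : ℝ := 580 * t * (6 * c + 1) with hD
  have hD0 : 0 ≤ D := by positivity
  obtain ⟨k, hk, hk1⟩ := ((hlim.eventually_lt_const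
    (show (0 : ℝ) < 1 / (D + 1) by positivity)).and (Filter.eventually_ge_atTop 1)).exists
  have hk1' : (1 : ℝ) ≤ k := by exact_mod_cast hk1
  have hb : (2 : ℝ) ^ k ≤ 580 * t * (c * (2 * k + 4) + 1) := by exact_mod_cast hbound k
  have hb' : (580 : ℝ) * t * (c * (2 * k + 4) + 1) ≤ D * k := by
    have : (c : ℝ) * (2 * k + 4) + 1 ≤ (6 * c + 1) * k := by
      have h0 : (0 : ℝ) ≤ c * (k - 1) := mul_nonneg (Nat.cast_nonneg c) (by linarith)
      linarith
    calc (580 : ℝ) * t * (c * (2 * k + 4) + 1) ≤ 580 * t * ((6 * c + 1) * k) := by gcongr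
      _ = D * k := by rw [hD]; ring
  rw [pow_one, div_lt_div_iff₀ (by positivity) (by positivity)] at hk
  linarith

end TriangleGadget

theorem mainTheorem5 (N : ℕ → ℕ) (hN : ∀ n, n ≤ N n)
    (hpoly : ∃ d : ℕ, ∀ n, 1 ≤ n → N n ≤ d * n ^ d) :
    (ClassBL N \ (BStar N ∪ LStar N)).Nonempty ∧
      TOMDF ∈ ClassBL N \ (BStar N ∪ LStar N) := by
  have h : TOMDF ∈ ClassBL N \ (BStar N ∪ LStar N) :=
    ⟨TOMDF_mem_ClassBL N, fun h => h.elim (TOMDF_notMem_BStar hN) (TOMDF_notMem_LStar hN)⟩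
  exact ⟨⟨_, h⟩, h⟩
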